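/- A pure state of $N$ qubits is a unit vector of $(\mathbb C^2)^{\otimes N}$. Let $\mathcal P_N=\{I,X,Y,Z\}^{\otimes N}$ be the set of $N$-qubit Pauli observables; a Clifford unitary is an $N$-qubit unitary $U$ with $U\,G\,U^\dagger\subseteq G$, where $G=\{i^rP: r\in\{0,1,2,3\},\ P\in\mathcal P_N\}$ is the Pauli group. Let $|CCZ\rangle=\frac1{\sqrt8}\sum_{b\in\{0,1\}^3}(-1)^{b_1b_2b_3}|b\rangle$. The $n$-qubit modular adder $A_n$ is the unitary on two $n$-qubit registers given by $A_n|i\rangle|j\rangle=|i\rangle|(i+j)\bmod 2^n\rangle$ for $0\le i,j<2^n$. An implementation of $A_n$ from $k$ copies of $|CCZ\rangle$ by stabilizer operations with measurement probabilities one half is a finite adaptive protocol on $2n+3k+m$ qubits, for some $m\ge 0$, composed of Clifford unitaries and measurements of Pauli observables (each step may depend on the earlier measurement outcomes), such that for every $2n$-qubit input state $|\psi\rangle$, when the protocol is started in $|\psi\rangle\otimes|CCZ\rangle^{\otimes k}\otimes|0\rangle^{\otimes m}$, * at every measurement that is performed each of the two outcomes $\pm1$ has conditional probability exactly $1/2$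 given the earlier outcomes, and * for every sequence of outcomes the final state is $A_n|\psi\rangle\otimes|\chi\rangle$ for some state $|\chi\rangle$ of the remaining $3k+m$ qubits. **Lemma.** Let $n\ge 3$. Every implementation of the $n$-qubit modular adder from $k$ copies of $|CCZ\rangle$ by stabilizer operations with measurement probabilities one half satisfies $k\ge n-2$. -/

import Mathlib

open scoped Matrix

namespace Stabilizer

/-- A (not necessarily normalised) pure state of a register of qubits labelled by `ι`:
its amplitudes in the computational basis `{0,1}^ι`. -/
abbrev State (ι : Type) : Type := (ι → Fin 2) → ℂ

/-- An operator on a register of qubits labelled by `ι`, as a matrix in the computational basis. -/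
abbrev Op (ι : Type) : Type := Matrix (ι → Fin 2) (ι → Fin 2) ℂ

/-- The squared norm `⟨ψ|ψ⟩` of a state. -/
noncomputable def normSq {ι : Type} [Fintype ι] [DecidableEq ι] (ψ : State ι) : ℝ :=
  ∑ b, ‖ψ b‖ ^ 2

/-- The tensor product of states of two registers. -/
def tensor {α β : Type} (ψ : State α) (χ : State β) : State (α ⊕ β) :=
  fun b => ψ (fun i => b (Sum.inl i)) * χ (fun j => b (Sum.inr j))

/-- Labels of the one-qubit Pauli matrices. -/
inductive Pauli : Type
  | I | X | Y | Z

/-- The one-qubit Pauli matrices. -/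
def Pauli.mat : Pauli → Matrix (Fin 2) (Fin 2) ℂ
  | .I => !![1, 0; 0, 1]
  | .X => !![0, 1; 1, 0]
  | .Y => !![0, -Complex.I; Complex.I, 0]
  | .Z => !![1, 0; 0, -1]

/-- The multi-qubit Pauli observable `⨂ i, P i`. -/
def pauliOp {ι : Type} [Fintype ι] (P : ι → Pauli) : Op ι :=
  Matrix.of fun a b => ∏ i, (P i).mat (a i) (b i)

/-- The Pauli group on the register: the operators `i ^ r P` with `P ∈ {I, X, Y, Z}^{⊗ ι}`. -/
def pauliGroup (ι : Type) [Fintype ι] : Set (Op ι) :=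
  {M | ∃ (r : ℕ) (P : ι → Pauli), M = Complex.I ^ r • pauliOp P}

/-- Clifford unitaries: the unitaries that conjugate the Pauli group into itself. -/
def IsClifford {ι : Type} [Fintype ι] [DecidableEq ι] (U : Op ι) : Prop :=
  U ∈ Matrix.unitaryGroup (ι → Fin 2) ℂ ∧ ∀ M ∈ pauliGroup ι, U * M * Uᴴ ∈ pauliGroup ι

/-- The eigenvalue of a Pauli observable that belongs to a measurement record:
`false` stands for `+1` and `true` for `-1`. -/
def outcomeSign (s : Bool) : ℂ := if s then -1 else 1

/-- The projection `(I ± P) / 2 |ψ⟩` of a state onto an eigenspace of a Pauli observable. -/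
noncomputable def project {ι : Type} [Fintype ι] [DecidableEq ι]
    (P : ι → Pauli) (s : Bool) (ψ : State ι) : State ι :=
  (1 / 2 : ℂ) • (ψ + outcomeSign s • (pauliOp P *ᵥ ψ))

/-- Born's rule: the probability of the outcome `s` when `P` is measured on the unit vector `ψ`. -/
noncomputable def outcomeProb {ι : Type} [Fintype ι] [DecidableEq ι]
    (P : ι → Pauli) (s : Bool) (ψ : State ι) : ℝ :=
  normSq (project P s ψ)

/-- The normalised state after the outcome `s` has been observed. -/
noncomputable def postMeasure {ι : Type} [Fintype ι] [DecidableEq ι]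
    (P : ι → Pauli) (s : Bool) (ψ : State ι) : State ι :=
  ((Real.sqrt (outcomeProb P s ψ))⁻¹ : ℂ) • project P s ψ

/-- An adaptive protocol of Clifford unitaries and Pauli measurements on a register: a finite tree
in which everything that follows a measurement may depend on its outcome. -/
inductive Protocol (ι : Type) [Fintype ι] [DecidableEq ι] : Type
  | done : Protocol ι
  | clifford (U : Op ι) (hU : IsClifford U) (next : Protocol ι) : Protocol ι
  | measure (P : ι → Pauli) (next : Bool → Protocol ι) : Protocol ι

/-- The possible final states of a protocol on a given initial state, one for each sequence of
measurement outcomes of non-zero probability. -/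
def Protocol.outputs {ι : Type} [Fintype ι] [DecidableEq ι] :
    Protocol ι → State ι → Set (State ι)
  | .done, ψ => {ψ}
  | .clifford U _ next, ψ => next.outputs (U *ᵥ ψ)
  | .measure P next, ψ =>
      {φ | ∃ s : Bool, outcomeProb P s ψ ≠ 0 ∧ φ ∈ (next s).outputs (postMeasure P s ψ)}

/-- On the given initial state, both outcomes of every measurement that the protocol performs have
(conditional on the earlier outcomes) probability `1/2`. -/
def Protocol.HalfProb {ι : Type} [Fintype ι] [DecidableEq ι] :
    Protocol ι → State ι → Prop
  | .done, _ => True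
  | .clifford U _ next, ψ => next.HalfProb (U *ᵥ ψ)
  | .measure P next, ψ =>
      ∀ s : Bool, outcomeProb P s ψ = 1 / 2 ∧ (next s).HalfProb (postMeasure P s ψ)

/-- The state `|CCZ⟩ = CCZ |+⟩^{⊗ 3}`. -/
noncomputable def cczState : State (Fin 3) :=
  fun b => (-1 : ℂ) ^ ((b 0 : ℕ) * (b 1 : ℕ) * (b 2 : ℕ)) / (Real.sqrt 8 : ℂ)

/-- The state `|CCZ⟩^{⊗ k}`; the qubit `(j, t)` is the `t`-th qubit of the `j`-th copy. -/
noncomputable def cczStates (k : ℕ) : State (Fin k × Fin 3) :=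
  fun b => ∏ j, cczState (fun t => b (j, t))

/-- The ancilla state `|0⟩^{⊗ m}`. -/
def zeroState (m : ℕ) : State (Fin m) :=
  fun b => if b = 0 then 1 else 0

/-- A data register `ι`, the qubits of `k` copies of `|CCZ⟩`, and `m` ancilla qubits. -/
abbrev Register (ι : Type) (k m : ℕ) : Type := ι ⊕ ((Fin k × Fin 3) ⊕ Fin m)

/-- The initial state `|ψ⟩ ⊗ |CCZ⟩^{⊗ k} ⊗ |0⟩^{⊗ m}`. -/
noncomputable def initialState {ι : Type} (k m : ℕ) (ψ : State ι) : State (Register ι k m) :=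
  tensor ψ (tensor (cczStates k) (zeroState m))

/-- A protocol implements the unitary `V` on the data register by stabilizer operations with
measurement probabilities one half, from `k` copies of `|CCZ⟩` and `m` stabilizer ancillas: on
every input state `ψ` all measurement outcomes have probability `1/2` and, whatever they are, the
data register ends in the state `V |ψ⟩`, unentangled with the remaining qubits. -/
def Implements {ι : Type} [Fintype ι] [DecidableEq ι] {k m : ℕ}
    (p : Protocol (Register ι k m)) (V : Op ι) : Prop :=
  ∀ ψ : State ι, normSq ψ = 1 →
    p.HalfProb (initialState k m ψ) ∧
    ∀ φ ∈ p.outputs (initialState k m ψ),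
      ∃ χ : State ((Fin k × Fin 3) ⊕ Fin m), φ = tensor (V *ᵥ ψ) χ

/-- Addition modulo `2 ^ n` on basis labels: `(i, j) ↦ (i, i + j)`, where a string of `n` bits is
read as an element of `Fin (2 ^ n)` in binary. -/
def addBits (n : ℕ) (b : Fin n ⊕ Fin n → Fin 2) : Fin n ⊕ Fin n → Fin 2 :=
  Sum.elim (fun r => b (Sum.inl r))
    (finFunctionFinEquiv.symm
      (finFunctionFinEquiv (fun r => b (Sum.inl r)) + finFunctionFinEquiv (fun r => b (Sum.inr r))))

/-- The `n`-qubit modular adder `A |i⟩|j⟩ = |i⟩|i + j mod 2 ^ n⟩`. -/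
def adder (n : ℕ) : Op (Fin n ⊕ Fin n) :=
  Matrix.of fun a b => if a = addBits n b then 1 else 0

end Stabilizer

/-! The argument tracks the denominators of Pauli expectation values. Call a state `k`-dyadic if `2
^ k` times each of its Pauli expectations is a Gaussian integer. The stabilizer product states used
as input are `0`-dyadic and `|CCZ⟩` is `1`-dyadic; levels add under tensor products, so the initial
state of a protocol is `k`-dyadic.

No step of the protocol raises the level. A Clifford permutes Paulis up to powers of `I`. A
measurement of probability exactly `1 / 2` rescales by 2, which turns the projected expectation of
`Q` into either 0 or a sum of two old Pauli expectations up to sign (`IsDyadic.postMeasure`). Hence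
some output is `k`-dyadic, and reading it with the identity off the data register makes every Pauli
expectation of `V ψ` a Gaussian integer over `2 ^ k`.

For the adder with `n = d + 1`, take `i` and `j` uniform below `2 ^ d`. The top bit of the sum is
then the carry, and its `Z` expectation is `2 ^ d / 4 ^ d = 1 / 2 ^ d`, forcing `d ≤ k`. -/

namespace Stabilizer

/-! ### Dyadic states and Pauli algebra -/

/-- The Gaussian integers as a subring of `ℂ`. -/
noncomputable def gaussianIntegers : Subring ℂ := GaussianInt.toComplex.range

lemma I_mem_gaussianIntegers : Complex.I ∈ gaussianIntegers :=
  ⟨⟨0, 1⟩, by simp [GaussianInt.toComplex_def]⟩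

/-- The quadratic form `⟨ψ|M|ψ⟩`. -/
noncomputable def expVal {ι : Type} [Fintype ι] [DecidableEq ι] (M : Op ι) (ψ : State ι) : ℂ :=
  star ψ ⬝ᵥ (M *ᵥ ψ)

/-- All Pauli expectation values of `ψ` are Gaussian integers divided by `2 ^ k`. -/
def IsDyadic {ι : Type} [Fintype ι] [DecidableEq ι] (k : ℕ) (ψ : State ι) : Prop :=
  ∀ P : ι → Pauli, 2 ^ k * expVal (pauliOp P) ψ ∈ gaussianIntegers

lemma Pauli.mat_conjTranspose (p : Pauli) : p.matᴴ = p.mat := by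
  cases p <;> ext i j <;> fin_cases i <;> fin_cases j <;> simp [Pauli.mat]

lemma Pauli.mat_mul_self (p : Pauli) : p.mat * p.mat = 1 := by
  cases p <;> ext i j <;> fin_cases i <;> fin_cases j <;>
    simp [Pauli.mat, Matrix.mul_apply, Fin.sum_univ_two]

lemma Pauli.mat_mul (p q : Pauli) :
    ∃ (r : ℕ) (u : Pauli), p.mat * q.mat = Complex.I ^ r • u.mat := by
  have I3 : Complex.I ^ 3 = -Complex.I := by rw [pow_succ, Complex.I_sq]; simp
  let ru : ℕ × Pauli := match p, q with
    | .I, u => (0, u)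
    | u, .I => (0, u)
    | .X, .X | .Y, .Y | .Z, .Z => (0, .I)
    | .X, .Y => (1, .Z)
    | .Y, .Z => (1, .X)
    | .Z, .X => (1, .Y)
    | .Y, .X => (3, .Z)
    | .Z, .Y => (3, .X)
    | .X, .Z => (3, .Y)
  refine ⟨ru.1, ru.2, ?_⟩
  cases p <;> cases q <;> ext i j <;> fin_cases i <;> fin_cases j <;>
    simp [ru, Pauli.mat, Matrix.mul_apply, Fin.sum_univ_two, I3]

lemma Pauli.mat_comm (p q : Pauli) :
    ∃ e : ℤˣ, p.mat * q.mat = (e : ℂ) • (q.mat * p.mat) := by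
  cases p <;> cases q <;>
  first
  | (refine ⟨1, ?_⟩; ext i j; revert i j; simp [Pauli.mat, Fin.forall_fin_two]; done)
  | (refine ⟨-1, ?_⟩; ext i j; revert i j; simp [Pauli.mat, Fin.forall_fin_two]; done)

lemma pauliOp_conjTranspose {ι : Type} [Fintype ι] (P : ι → Pauli) : (pauliOp P)ᴴ = pauliOp P := by
  ext a b
  simp only [pauliOp, Matrix.conjTranspose_apply, Matrix.of_apply, star_prod]
  exact Finset.prod_congr rfl fun i _ => by
    rw [← Matrix.conjTranspose_apply, Pauli.mat_conjTranspose]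

lemma finite_pauliGroup {ι : Type} [Fintype ι] : (pauliGroup ι).Finite := by
  classical
  have : Finite Pauli := Finite.of_injective
    (fun p : Pauli => match p with | .I => (0 : Fin 4) | .X => 1 | .Y => 2 | .Z => 3)
    (by intro p q; cases p <;> cases q <;> simp)
  refine (Set.finite_range fun x : Fin 4 × (ι → Pauli) =>
    Complex.I ^ (x.1 : ℕ) • pauliOp x.2).subset ?_
  rintro _ ⟨r, P, rfl⟩
  refine ⟨(⟨r % 4, Nat.mod_lt _ (by norm_num)⟩, P), ?_⟩
  simp only [← Complex.I_pow_eq_pow_mod]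

lemma pauliOp_I {ι : Type} [Fintype ι] : pauliOp (fun _ : ι => Pauli.I) = 1 := by
  have h : Pauli.I.mat = 1 := by
    ext i j; fin_cases i <;> fin_cases j <;> simp [Pauli.mat]
  ext a b
  simp only [pauliOp, Matrix.of_apply, h, Matrix.one_apply, Finset.prod_ite_zero,
    Finset.prod_const_one, Finset.mem_univ, true_imp_iff, funext_iff]

section
variable {ι : Type} [Fintype ι] [DecidableEq ι]

lemma pauliOp_mul_apply (P Q : ι → Pauli) (a b : ι → Fin 2) :
    (pauliOp P * pauliOp Q) a b = ∏ i, ((P i).mat * (Q i).mat) (a i) (b i) := by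
  simp only [Matrix.mul_apply, pauliOp, Matrix.of_apply, ← Finset.prod_mul_distrib]
  rw [Finset.prod_univ_sum, Fintype.piFinset_univ]

lemma pauliOp_mul_self (P : ι → Pauli) : pauliOp P * pauliOp P = 1 := by
  ext a b
  simp only [pauliOp_mul_apply, Pauli.mat_mul_self, Matrix.one_apply, Finset.prod_ite_zero,
    Finset.prod_const_one, Finset.mem_univ, true_imp_iff, funext_iff]

lemma pauliOp_mul (P Q : ι → Pauli) :
    ∃ (r : ℕ) (R : ι → Pauli), pauliOp P * pauliOp Q = Complex.I ^ r • pauliOp R := by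
  choose r u h using fun i => Pauli.mat_mul (P i) (Q i)
  refine ⟨∑ i, r i, u, ?_⟩
  ext a b
  rw [pauliOp_mul_apply]
  simp [h, pauliOp, Finset.prod_mul_distrib, Finset.prod_pow_eq_pow_sum]

lemma pauliOp_comm (P Q : ι → Pauli) :
    ∃ e : ℤˣ, pauliOp P * pauliOp Q = (e : ℂ) • (pauliOp Q * pauliOp P) := by
  choose e h using fun i => Pauli.mat_comm (P i) (Q i)
  refine ⟨∏ i, e i, ?_⟩
  ext a b
  rw [Matrix.smul_apply, pauliOp_mul_apply, pauliOp_mul_apply]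
  simp [h, Finset.prod_mul_distrib]

/-- The definition only controls conjugation by `U`, whereas Heisenberg evolution of observables
needs its inverse. Conjugation is injective on a finite group, hence surjective onto it. -/
lemma IsClifford.conjTranspose_mul_mul_mem {U : Op ι} (hU : IsClifford U) {M : Op ι}
    (hM : M ∈ pauliGroup ι) : Uᴴ * M * U ∈ pauliGroup ι := by
  have h1 : Uᴴ * U = 1 := Matrix.mem_unitaryGroup_iff'.mp hU.1
  have cancel : ∀ N : Op ι, Uᴴ * (U * N * Uᴴ) * U = N := fun N => by
    calc Uᴴ * (U * N * Uᴴ) * U = (Uᴴ * U) * N * (Uᴴ * U) := by simp only [Matrix.mul_assoc]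
      _ = N := by rw [h1, Matrix.one_mul, Matrix.mul_one]
  have hinj : Set.InjOn (fun N : Op ι => U * N * Uᴴ) (pauliGroup ι) := fun A _ B _ h => by
    rw [← cancel A, ← cancel B]; exact congrArg (fun N => Uᴴ * N * U) h
  obtain ⟨N, hN, rfl⟩ := Set.surj_on_of_inj_on_of_ncard_le (fun N _ => U * N * Uᴴ)
    (fun N hN => hU.2 N hN) (fun _ _ h1 h2 h => hinj h1 h2 h) le_rfl finite_pauliGroup M hM
  simpa only [cancel] using hN

/-! ### Expectation values under Cliffords and measurements -/

lemma star_mulVec_dotProduct (M : Op ι) (ψ φ : State ι) :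
    star (M *ᵥ ψ) ⬝ᵥ φ = star ψ ⬝ᵥ (Mᴴ *ᵥ φ) := by
  rw [Matrix.star_mulVec, Matrix.dotProduct_mulVec]

lemma normSq_eq_expVal (ψ : State ι) : (normSq ψ : ℂ) = expVal 1 ψ := by
  simp only [normSq, expVal, Matrix.one_mulVec, dotProduct, Pi.star_apply, Complex.star_def,
    Complex.conj_mul']
  push_cast
  rfl

lemma expVal_mulVec (M U : Op ι) (ψ : State ι) : expVal M (U *ᵥ ψ) = expVal (Uᴴ * M * U) ψ := by
  simp only [expVal, star_mulVec_dotProduct, Matrix.mulVec_mulVec, Matrix.mul_assoc]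

lemma expVal_smul_left (c : ℂ) (M : Op ι) (ψ : State ι) : expVal (c • M) ψ = c * expVal M ψ := by
  simp [expVal, Matrix.smul_mulVec]

lemma expVal_smul (c : ℂ) (M : Op ι) (ψ : State ι) :
    expVal M (c • ψ) = star c * c * expVal M ψ := by
  simp only [expVal, Matrix.mulVec_smul, dotProduct_smul, star_smul, smul_dotProduct, smul_eq_mul]
  ring

lemma expVal_add_left (M N : Op ι) (ψ : State ι) :
    expVal (M + N) ψ = expVal M ψ + expVal N ψ := by
  simp [expVal, Matrix.add_mulVec, dotProduct_add]

lemma IsDyadic.smul_mem {k : ℕ} {ψ : State ι} (h : IsDyadic k ψ) {M : Op ι}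
    (hM : M ∈ pauliGroup ι) : 2 ^ k * expVal M ψ ∈ gaussianIntegers := by
  obtain ⟨r, P, rfl⟩ := hM
  rw [expVal_smul_left, mul_left_comm]
  exact mul_mem (pow_mem I_mem_gaussianIntegers r) (h P)

lemma IsDyadic.clifford {k : ℕ} {ψ : State ι} (h : IsDyadic k ψ) {U : Op ι} (hU : IsClifford U) :
    IsDyadic k (U *ᵥ ψ) := fun P => by
  rw [expVal_mulVec]
  exact h.smul_mem (hU.conjTranspose_mul_mul_mem ⟨0, P, by simp⟩)

lemma normSq_clifford {ψ : State ι} {U : Op ι} (hU : IsClifford U) :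
    normSq (U *ᵥ ψ) = normSq ψ := by
  have h1 : Uᴴ * U = 1 := Matrix.mem_unitaryGroup_iff'.mp hU.1
  have := normSq_eq_expVal (U *ᵥ ψ)
  rw [expVal_mulVec, Matrix.mul_one, h1, ← normSq_eq_expVal] at this
  exact_mod_cast this

lemma normSq_smul (c : ℂ) (ψ : State ι) : normSq (c • ψ) = ‖c‖ ^ 2 * normSq ψ := by
  simp [normSq, mul_pow, Finset.mul_sum]

lemma normSq_postMeasure {P : ι → Pauli} {s : Bool} {ψ : State ι} (h : outcomeProb P s ψ ≠ 0) :
    normSq (postMeasure P s ψ) = 1 := by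
  have h0 : 0 ≤ outcomeProb P s ψ := Finset.sum_nonneg fun b _ => by positivity
  rw [postMeasure, normSq_smul, norm_inv, Complex.norm_real, inv_pow, Real.norm_eq_abs, sq_abs,
    Real.sq_sqrt h0]
  exact inv_mul_cancel₀ h

lemma expVal_postMeasure (M : Op ι) {P : ι → Pauli} {s : Bool} {ψ : State ι}
    (h : outcomeProb P s ψ = 1 / 2) :
    expVal M (postMeasure P s ψ) = (1 / 2 : ℂ) * (expVal M ψ + outcomeSign s * expVal (M * pauliOp P) ψ
      + outcomeSign s * expVal (pauliOp P * M) ψ + expVal (pauliOp P * M * pauliOp P) ψ) := by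
  have hs : star (outcomeSign s) = outcomeSign s := by cases s <;> simp [outcomeSign]
  have hs2 : outcomeSign s * outcomeSign s = 1 := by cases s <;> simp [outcomeSign]
  have hpr : project P s ψ = (1 / 2 : ℂ) • ((1 + outcomeSign s • pauliOp P) *ᵥ ψ) := by
    rw [project, Matrix.add_mulVec, Matrix.one_mulVec, Matrix.smul_mulVec]
  -- Renormalisation contributes 2 and the two projections contribute `1 / 4`, leaving the overall
  -- `1 / 2`.
  have hc : star ((Real.sqrt (1 / 2))⁻¹ : ℂ) * ((Real.sqrt (1 / 2))⁻¹ : ℂ) = 2 := by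
    rw [star_inv₀, Complex.star_def, Complex.conj_ofReal, ← mul_inv, ← Complex.ofReal_mul,
      Real.mul_self_sqrt (by norm_num)]
    norm_num
  have hM : (1 + outcomeSign s • pauliOp P)ᴴ * M * (1 + outcomeSign s • pauliOp P) =
      M + outcomeSign s • (M * pauliOp P) + outcomeSign s • (pauliOp P * M)
        + pauliOp P * M * pauliOp P := by
    rw [Matrix.conjTranspose_add, Matrix.conjTranspose_smul, pauliOp_conjTranspose, hs,
      Matrix.conjTranspose_one]
    simp only [Matrix.add_mul, Matrix.mul_add, Matrix.one_mul, Matrix.mul_one, Matrix.smul_mul,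
      Matrix.mul_smul, smul_add, smul_smul, hs2, one_smul]
    abel
  have hh : star (1 / 2 : ℂ) = 1 / 2 := by
    simp
  rw [postMeasure, h, expVal_smul, hc, hpr, expVal_smul, expVal_mulVec, hM, hh]
  simp only [expVal_add_left, expVal_smul_left]
  ring

/-- If `Q` commutes with `P`, the four terms of `expVal_postMeasure` coincide in pairs and cancel
the factor `1 / 2`; if it anticommutes, they sum to zero. This is where probability one half is
essential: another probability would bring in a different factor. -/
lemma IsDyadic.postMeasure {k : ℕ} {P : ι → Pauli} {s : Bool} {ψ : State ι} (hψ : IsDyadic k ψ)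
    (h : outcomeProb P s ψ = 1 / 2) : IsDyadic k (postMeasure P s ψ) := fun Q => by
  have hs : outcomeSign s ∈ gaussianIntegers := by
    cases s
    · exact one_mem _
    · exact neg_mem (one_mem _)
  obtain ⟨e, he⟩ := pauliOp_comm P Q
  have hPQP : pauliOp P * pauliOp Q * pauliOp P = (e : ℂ) • pauliOp Q := by
    rw [he, Matrix.smul_mul, Matrix.mul_assoc, pauliOp_mul_self, Matrix.mul_one]
  rw [expVal_postMeasure _ h, hPQP, he, expVal_smul_left, expVal_smul_left]
  have hQP : 2 ^ k * expVal (pauliOp Q * pauliOp P) ψ ∈ gaussianIntegers := by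
    obtain ⟨r, R, hR⟩ := pauliOp_mul Q P
    exact hψ.smul_mem ⟨r, R, hR⟩
  rcases Int.units_eq_one_or e with rfl | rfl
  · convert add_mem (hψ Q) (mul_mem hs hQP) using 1
    push_cast
    ring
  · convert zero_mem gaussianIntegers using 1
    push_cast
    ring

/-- If all measurement probabilities are `1 / 2`, then dyadic unit vectors stay dyadic, and some
sequence of outcomes has non-zero probability. -/
lemma Protocol.exists_isDyadic_output {k : ℕ} (p : Protocol ι) {ψ : State ι} (hψ : IsDyadic k ψ)
    (h1 : normSq ψ = 1) (hp : p.HalfProb ψ) :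
    ∃ φ ∈ p.outputs ψ, IsDyadic k φ ∧ normSq φ = 1 := by
  induction p generalizing ψ with
  | done => exact ⟨ψ, rfl, hψ, h1⟩
  | clifford U hU next ih => exact ih (hψ.clifford hU) ((normSq_clifford hU).trans h1) hp
  | measure P next ih =>
    have h := hp false
    have h0 : outcomeProb P false ψ ≠ 0 := by rw [h.1]; norm_num
    obtain ⟨φ, hφ, h'⟩ := ih false (hψ.postMeasure h.1) (normSq_postMeasure h0) h.2
    exact ⟨φ, ⟨false, h0, hφ⟩, h'⟩

end

/-! ### Product states and tensor products -/

section
variable {ι : Type} [Fintype ι] [DecidableEq ι]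

lemma expVal_eq_sum (M : Op ι) (ψ : State ι) :
    expVal M ψ = ∑ a, ∑ b, star (ψ a) * (M a b * ψ b) := by
  simp only [expVal, dotProduct, Matrix.mulVec, Pi.star_apply, Finset.mul_sum]

lemma sum_sum_prod_eq_prod_sum_sum {κ β : Type} [Fintype κ] [DecidableEq κ] [Fintype β]
    (F : κ → β → β → ℂ) :
    ∑ a : κ → β, ∑ b : κ → β, ∏ j, F j (a j) (b j) = ∏ j, ∑ x, ∑ y, F j x y := by
  simp only [Finset.prod_univ_sum, Fintype.piFinset_univ]

/-- The product of the one-qubit states `v i`. -/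
def productState (v : ι → Fin 2 → ℂ) : State ι := fun b => ∏ i, v i (b i)

lemma normSq_productState (v : ι → Fin 2 → ℂ) :
    normSq (productState v) = ∏ i, ∑ x, ‖v i x‖ ^ 2 := by
  simp only [normSq, productState, norm_prod, ← Finset.prod_pow, Finset.prod_univ_sum,
    Fintype.piFinset_univ]

lemma isDyadic_productState {v : ι → Fin 2 → ℂ}
    (hv : ∀ i, ∀ p : Pauli, ∑ x, ∑ y, star (v i x) * (p.mat x y * v i y) ∈ gaussianIntegers) :
    IsDyadic 0 (productState v) := fun P => by
  have h : expVal (pauliOp P) (productState v) =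
      ∏ i, ∑ x, ∑ y, star (v i x) * ((P i).mat x y * v i y) := by
    rw [← sum_sum_prod_eq_prod_sum_sum, expVal_eq_sum]
    simp only [productState, pauliOp, Matrix.of_apply, star_prod, Finset.prod_mul_distrib]
  rw [pow_zero, one_mul, h]
  exact prod_mem fun i _ => hv i (P i)

lemma ketZero_expVal_mem (p : Pauli) :
    ∑ x, ∑ y, star ((![1, 0] : Fin 2 → ℂ) x) * (p.mat x y * (![1, 0] : Fin 2 → ℂ) y)
      ∈ gaussianIntegers := by
  cases p <;> simp [Fin.sum_univ_two, Pauli.mat, zero_mem, one_mem]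

lemma inv_sqrt_two_mul_self : ((Real.sqrt 2 : ℂ))⁻¹ * ((Real.sqrt 2 : ℂ))⁻¹ = 1 / 2 := by
  rw [← mul_inv, ← Complex.ofReal_mul, Real.mul_self_sqrt (by norm_num)]
  norm_num

lemma ketPlus_expVal_mem (p : Pauli) :
    ∑ x : Fin 2, ∑ y : Fin 2, star ((Real.sqrt 2 : ℂ)⁻¹) * (p.mat x y * (Real.sqrt 2 : ℂ)⁻¹)
      ∈ gaussianIntegers := by
  have h : ∀ c : ℂ, star ((Real.sqrt 2 : ℂ)⁻¹) * (c * (Real.sqrt 2 : ℂ)⁻¹) = c * (1 / 2) := by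
    intro c
    rw [star_inv₀, Complex.star_def, Complex.conj_ofReal, mul_left_comm, inv_sqrt_two_mul_self]
  simp only [h]
  cases p
  · convert one_mem gaussianIntegers using 1
    simp [Fin.sum_univ_two, Pauli.mat]; norm_num
  · convert one_mem gaussianIntegers using 1
    simp [Fin.sum_univ_two, Pauli.mat]; norm_num
  · convert zero_mem gaussianIntegers using 1
    simp [Fin.sum_univ_two, Pauli.mat]
  · convert zero_mem gaussianIntegers using 1
    simp [Fin.sum_univ_two, Pauli.mat]

end

section
variable {α β : Type} [Fintype α] [DecidableEq α] [Fintype β] [DecidableEq β]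

lemma sum_sum_type_arrow {R : Type} [AddCommMonoid R] (f : (α ⊕ β → Fin 2) → R) :
    ∑ b, f b = ∑ x : α → Fin 2, ∑ y : β → Fin 2, f (Sum.elim x y) := by
  rw [← Fintype.sum_prod_type']
  exact (Equiv.sum_comp (Equiv.sumArrowEquivProdArrow α β (Fin 2)).symm f).symm

lemma normSq_tensor (ψ : State α) (χ : State β) :
    normSq (tensor ψ χ) = normSq ψ * normSq χ := by
  simp only [normSq, sum_sum_type_arrow, tensor, Sum.elim_inl, Sum.elim_inr, norm_mul, mul_pow,
    Finset.sum_mul_sum]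

lemma expVal_tensor (P : α ⊕ β → Pauli) (ψ : State α) (χ : State β) :
    expVal (pauliOp P) (tensor ψ χ) =
      expVal (pauliOp fun i => P (Sum.inl i)) ψ * expVal (pauliOp fun j => P (Sum.inr j)) χ := by
  simp only [expVal_eq_sum, sum_sum_type_arrow, tensor, Sum.elim_inl, Sum.elim_inr, pauliOp,
    Matrix.of_apply, Fintype.prod_sum_type, Finset.sum_mul_sum, star_mul']
  refine Finset.sum_congr rfl fun a _ => Finset.sum_congr rfl fun a' _ =>
    Finset.sum_congr rfl fun b _ => Finset.sum_congr rfl fun b' _ => ?_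
  ring

lemma IsDyadic.tensor {j k : ℕ} {ψ : State α} {χ : State β} (hψ : IsDyadic j ψ)
    (hχ : IsDyadic k χ) : IsDyadic (j + k) (tensor ψ χ) := fun P => by
  rw [expVal_tensor, pow_add, mul_mul_mul_comm]
  exact mul_mem (hψ _) (hχ _)

end

/-! ### The resource states -/

/-- The integer matrix with `p.mat = I ^ r • p.intMat`, where `r = 1` for `Y` and `r = 0`
otherwise. -/
def Pauli.intMat : Pauli → Matrix (Fin 2) (Fin 2) ℤ
  | .I => !![1, 0; 0, 1]
  | .X => !![0, 1; 1, 0]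
  | .Y => !![0, -1; 1, 0]
  | .Z => !![1, 0; 0, -1]

lemma Pauli.exists_mat_eq (p : Pauli) :
    ∃ r : ℕ, ∀ x y, p.mat x y = Complex.I ^ r * (p.intMat x y : ℂ) := by
  cases p
  case Y => exact ⟨1, fun x y => by fin_cases x <;> fin_cases y <;> simp [Pauli.mat, Pauli.intMat]⟩
  all_goals exact ⟨0, fun x y => by
    fin_cases x <;> fin_cases y <;> simp [Pauli.mat, Pauli.intMat]⟩

/-- With the phases of `Y` factored out, this integer sum is 8 times a Pauli expectation of `|CCZ⟩`;
divisibility by 4 leaves a denominator of at most 2. It is a finite check over 64 Pauli triples. -/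
lemma four_dvd_ccz_sum (p q r : Pauli) :
    (4 : ℤ) ∣ ∑ a₀ : Fin 2, ∑ a₁ : Fin 2, ∑ a₂ : Fin 2, ∑ b₀ : Fin 2, ∑ b₁ : Fin 2, ∑ b₂ : Fin 2,
      (-1) ^ ((a₀ : ℕ) * (a₁ : ℕ) * (a₂ : ℕ)) *
        (p.intMat a₀ b₀ * q.intMat a₁ b₁ * r.intMat a₂ b₂) *
        (-1) ^ ((b₀ : ℕ) * (b₁ : ℕ) * (b₂ : ℕ)) := by
  cases p <;> cases q <;> cases r <;> decide +kernel

lemma sum_fin_three_arrow {R : Type} [AddCommMonoid R] (f : (Fin 3 → Fin 2) → R) :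
    ∑ b, f b = ∑ x : Fin 2, ∑ y : Fin 2, ∑ z : Fin 2, f ![x, y, z] := by
  let e : Fin 2 × Fin 2 × Fin 2 ≃ (Fin 3 → Fin 2) :=
    { toFun := fun t => ![t.1, t.2.1, t.2.2]
      invFun := fun b => (b 0, b 1, b 2)
      left_inv := fun _ => rfl
      right_inv := fun b => by ext i; fin_cases i <;> rfl }
  rw [← Equiv.sum_comp e, Fintype.sum_prod_type]
  simp only [Fintype.sum_prod_type]
  rfl

lemma sqrt_eight_mul_self : (Real.sqrt 8 : ℂ) * (Real.sqrt 8 : ℂ) = 8 := by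
  rw [← Complex.ofReal_mul, Real.mul_self_sqrt (by norm_num)]
  norm_num

lemma isDyadic_cczState : IsDyadic 1 cczState := fun P => by
  choose r hr using fun i => (P i).exists_mat_eq
  obtain ⟨c, hc⟩ := four_dvd_ccz_sum (P 0) (P 1) (P 2)
  have h : expVal (pauliOp P) cczState =
      Complex.I ^ r 0 * Complex.I ^ r 1 * Complex.I ^ r 2 / 8 * ((4 * c : ℤ) : ℂ) := by
    rw [← hc, expVal_eq_sum]
    simp only [sum_fin_three_arrow]
    push_cast
    simp only [Finset.mul_sum]
    refine Finset.sum_congr rfl fun a₀ _ => Finset.sum_congr rfl fun a₁ _ =>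
      Finset.sum_congr rfl fun a₂ _ => Finset.sum_congr rfl fun b₀ _ =>
      Finset.sum_congr rfl fun b₁ _ => Finset.sum_congr rfl fun b₂ _ => ?_
    simp only [cczState, pauliOp, Matrix.of_apply, Fin.prod_univ_three, hr, star_div₀, star_pow,
      star_neg, star_one, Complex.star_def, Complex.conj_ofReal, Matrix.cons_val]
    rw [← sqrt_eight_mul_self]
    field_simp
  have h' : 2 ^ 1 * expVal (pauliOp P) cczState =
      Complex.I ^ r 0 * Complex.I ^ r 1 * Complex.I ^ r 2 * (c : ℂ) := by
    rw [h]; push_cast; ring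
  rw [h']
  have hI := fun m => pow_mem I_mem_gaussianIntegers m
  exact mul_mem (mul_mem (mul_mem (hI _) (hI _)) (hI _)) (intCast_mem _ c)

lemma normSq_cczState : normSq cczState = 1 := by
  have h : ∀ b : Fin 3 → Fin 2, ‖cczState b‖ ^ 2 = 1 / 8 := fun b => by
    simp [cczState]
  simp [normSq, h]

lemma isDyadic_cczStates (k : ℕ) : IsDyadic k (cczStates k) := fun P => by
  let e := (Equiv.curry (Fin k) (Fin 3) (Fin 2)).symm
  have h : expVal (pauliOp P) (cczStates k) =
      ∏ j, expVal (pauliOp fun t => P (j, t)) cczState := by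
    simp only [expVal_eq_sum]
    rw [← sum_sum_prod_eq_prod_sum_sum, ← Equiv.sum_comp e]
    refine Finset.sum_congr rfl fun a _ => ?_
    rw [← Equiv.sum_comp e]
    refine Finset.sum_congr rfl fun b _ => ?_
    simp only [cczStates, pauliOp, Matrix.of_apply, star_prod, Finset.prod_mul_distrib,
      Fintype.prod_prod_type]
    rfl
  have h2 : (2 : ℂ) ^ k = ∏ _j : Fin k, 2 ^ 1 := by simp
  rw [h, h2, ← Finset.prod_mul_distrib]
  exact prod_mem fun j _ => isDyadic_cczState _

lemma normSq_cczStates (k : ℕ) : normSq (cczStates k) = 1 := by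
  have h : normSq (cczStates k) = ∏ _j : Fin k, normSq cczState := by
    simp only [normSq, Finset.prod_univ_sum, Fintype.piFinset_univ]
    rw [← Equiv.sum_comp (Equiv.curry (Fin k) (Fin 3) (Fin 2)).symm]
    refine Finset.sum_congr rfl fun a _ => ?_
    rw [cczStates, norm_prod, Finset.prod_pow]
    rfl
  rw [h, normSq_cczState, Finset.prod_const_one]

lemma zeroState_eq_productState (m : ℕ) : zeroState m = productState fun _ => ![1, 0] := by
  ext b
  have h : ∀ x : Fin 2, (![1, 0] : Fin 2 → ℂ) x = if x = 0 then 1 else 0 := by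
    intro x; fin_cases x <;> simp
  simp only [zeroState, productState, h, Finset.prod_ite_zero, Finset.prod_const_one, funext_iff,
    Finset.mem_univ, true_imp_iff, Pi.zero_apply]

lemma isDyadic_zeroState (m : ℕ) : IsDyadic 0 (zeroState m) := by
  rw [zeroState_eq_productState]
  exact isDyadic_productState fun _ => ketZero_expVal_mem

lemma normSq_zeroState (m : ℕ) : normSq (zeroState m) = 1 := by
  simp [zeroState_eq_productState, normSq_productState]

lemma isDyadic_initialState {ι : Type} [Fintype ι] [DecidableEq ι] (k m : ℕ) {ψ : State ι}
    (hψ : IsDyadic 0 ψ) : IsDyadic k (initialState k m ψ) := by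
  simpa [initialState] using hψ.tensor ((isDyadic_cczStates k).tensor (isDyadic_zeroState m))

lemma normSq_initialState {ι : Type} [Fintype ι] [DecidableEq ι] (k m : ℕ) (ψ : State ι) :
    normSq (initialState k m ψ) = normSq ψ := by
  simp [initialState, normSq_tensor, normSq_cczStates, normSq_zeroState]

/-! ### The lower bound from one expectation value -/

/-- If `V` takes a stabilizer state to a state with a Pauli expectation value `1 / 2 ^ d`, then
implementing `V` takes `d` copies of `|CCZ⟩`. -/
lemma Implements.le_of_expVal_eq {ι : Type} [Fintype ι] [DecidableEq ι] {k m d : ℕ}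
    {p : Protocol (Register ι k m)} {V : Op ι} (hp : Implements p V) {ψ : State ι}
    (hψ : IsDyadic 0 ψ) (h1 : normSq ψ = 1) (hV : normSq (V *ᵥ ψ) = 1) (P : ι → Pauli)
    (hP : expVal (pauliOp P) (V *ᵥ ψ) = 1 / 2 ^ d) : d ≤ k := by
  obtain ⟨hhalf, hout⟩ := hp ψ h1
  obtain ⟨φ, hφ, hdy, hn⟩ := p.exists_isDyadic_output (isDyadic_initialState k m hψ)
    ((normSq_initialState k m ψ).trans h1) hhalf
  obtain ⟨χ, rfl⟩ := hout φ hφ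
  rw [normSq_tensor, hV, one_mul] at hn
  -- The identity on the remaining qubits contributes only `normSq χ`, which `hn` shows to be 1.
  have h := hdy (Sum.elim P fun _ => Pauli.I)
  rw [expVal_tensor] at h
  simp only [Sum.elim_inl, Sum.elim_inr] at h
  rw [pauliOp_I, ← normSq_eq_expVal, hn, hP] at h
  obtain ⟨z, hz⟩ := h
  have hre := congrArg Complex.re (show (z : ℂ) * 2 ^ d = 2 ^ k by
    rw [show (z : ℂ) = _ from hz]; simp)
  have hint : z.re * 2 ^ d = 2 ^ k := by
    have e1 : ((2 : ℂ) ^ d) = ((2 ^ d : ℝ) : ℂ) := by push_cast; rfl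
    have e2 : ((2 : ℂ) ^ k) = ((2 ^ k : ℝ) : ℂ) := by push_cast; rfl
    rw [e1, e2, Complex.re_mul_ofReal, Complex.ofReal_re, ← GaussianInt.intCast_re] at hre
    exact_mod_cast hre
  have hdvd : (2 : ℕ) ^ d ∣ 2 ^ k := by
    have : (2 : ℤ) ^ d ∣ 2 ^ k := ⟨z.re, by rw [← hint, mul_comm]⟩
    exact_mod_cast this
  exact (Nat.pow_dvd_pow_iff_le_right (by norm_num)).mp hdvd

/-! ### The adder as a permutation of basis states -/

lemma addBits_injective (n : ℕ) : Function.Injective (addBits n) := fun b b' h => by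
  have hl : (fun r => b (Sum.inl r)) = fun r => b' (Sum.inl r) :=
    funext fun r => by simpa [addBits] using congrFun h (Sum.inl r)
  have hr := funext fun r => congrFun h (Sum.inr r)
  simp only [addBits, Sum.elim_inr, hl] at hr
  have hr' := finFunctionFinEquiv.injective (add_left_cancel (finFunctionFinEquiv.symm.injective hr))
  ext q
  rcases q with q | q
  · exact congrArg _ (congrFun hl q)
  · exact congrArg _ (congrFun hr' q)

lemma adder_mulVec_addBits (n : ℕ) (ψ : State (Fin n ⊕ Fin n)) (b : Fin n ⊕ Fin n → Fin 2) :
    (adder n *ᵥ ψ) (addBits n b) = ψ b := by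
  simp [adder, Matrix.mulVec, dotProduct, (addBits_injective n).eq_iff]

lemma sum_addBits {R : Type} [AddCommMonoid R] (n : ℕ) (f : (Fin n ⊕ Fin n → Fin 2) → R) :
    ∑ b, f (addBits n b) = ∑ b, f b :=
  Equiv.sum_comp (Equiv.ofBijective _ (Finite.injective_iff_bijective.mp (addBits_injective n))) f

lemma normSq_adder_mulVec (n : ℕ) (ψ : State (Fin n ⊕ Fin n)) :
    normSq (adder n *ᵥ ψ) = normSq ψ := by
  simp only [normSq]
  rw [← sum_addBits]
  simp only [adder_mulVec_addBits]

/-- The observable `Z` on the qubit `q`. -/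
def pauliZ {ι : Type} [DecidableEq ι] (q : ι) : ι → Pauli := fun i => if i = q then .Z else .I

lemma pauliOp_pauliZ {ι : Type} [Fintype ι] [DecidableEq ι] (q : ι) :
    pauliOp (pauliZ q) = Matrix.diagonal fun a => (-1 : ℂ) ^ (a q : ℕ) := by
  have h : ∀ i, ∀ x y : Fin 2, (pauliZ q i).mat x y =
      (if x = y then 1 else 0) * if i = q then (-1 : ℂ) ^ (x : ℕ) else 1 := by
    intro i x y
    by_cases hi : i = q <;> fin_cases x <;> fin_cases y <;> simp [pauliZ, hi, Pauli.mat]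
  ext a b
  simp only [pauliOp, Matrix.of_apply, h, Finset.prod_mul_distrib, Finset.prod_ite_eq',
    Finset.mem_univ, if_true, Finset.prod_ite_zero, Finset.prod_const_one, true_imp_iff,
    Matrix.diagonal_apply, funext_iff]
  simp

lemma expVal_pauliZ {ι : Type} [Fintype ι] [DecidableEq ι] (q : ι) (ψ : State ι) :
    expVal (pauliOp (pauliZ q)) ψ = ((∑ b, (-1) ^ (b q : ℕ) * ‖ψ b‖ ^ 2 : ℝ) : ℂ) := by
  rw [pauliOp_pauliZ, expVal, dotProduct]
  push_cast
  refine Finset.sum_congr rfl fun b _ => ?_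
  rw [Matrix.mulVec_diagonal, Pi.star_apply, mul_left_comm, Complex.star_def, Complex.conj_mul']

/-! ### The half-range input and its carry statistics -/

/-- The one-qubit factors of the `(d + 1)`-qubit state with `|0⟩` on the most significant qubit and
`|+⟩` on the others. -/
noncomputable def halfRangeFactor (d : ℕ) (i : Fin (d + 1)) : Fin 2 → ℂ :=
  if i = Fin.last d then ![1, 0] else fun _ => (Real.sqrt 2 : ℂ)⁻¹

/-- The uniform superposition of the basis states `|i⟩|j⟩` with `i, j < 2 ^ d`, on two registers of
`d + 1` qubits. -/
noncomputable def halfRangeState (d : ℕ) : State (Fin (d + 1) ⊕ Fin (d + 1)) :=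
  productState (Sum.elim (halfRangeFactor d) (halfRangeFactor d))

lemma isDyadic_halfRangeState (d : ℕ) : IsDyadic 0 (halfRangeState d) := by
  have h : ∀ i, ∀ p : Pauli, ∑ x, ∑ y, star (halfRangeFactor d i x) *
      (p.mat x y * halfRangeFactor d i y) ∈ gaussianIntegers := by
    intro i p
    unfold halfRangeFactor
    split_ifs
    · exact ketZero_expVal_mem p
    · exact ketPlus_expVal_mem p
  refine isDyadic_productState ?_
  rintro (i | i) p
  · exact h i p
  · exact h i p

lemma norm_inv_sqrt_two_sq : ‖(Real.sqrt 2 : ℂ)⁻¹‖ ^ 2 = 1 / 2 := by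
  simp

lemma normSq_halfRangeState (d : ℕ) : normSq (halfRangeState d) = 1 := by
  have h : ∀ i, ∑ x, ‖halfRangeFactor d i x‖ ^ 2 = 1 := by
    intro i
    unfold halfRangeFactor
    split_ifs
    · simp
    · simp only [norm_inv_sqrt_two_sq]; simp
  rw [halfRangeState, normSq_productState]
  exact Finset.prod_eq_one fun i _ => by rcases i with i | i <;> exact h i

lemma prod_norm_halfRangeFactor_sq (d : ℕ) (x : Fin (2 ^ (d + 1))) :
    ∏ i, ‖halfRangeFactor d i (finFunctionFinEquiv.symm x i)‖ ^ 2 =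
      if (x : ℕ) < 2 ^ d then (1 / 2) ^ d else 0 := by
  have hlast : (finFunctionFinEquiv.symm x (Fin.last d) : ℕ) = (x : ℕ) / 2 ^ d := by
    simp only [finFunctionFinEquiv_symm_apply_val, Fin.val_last]
    refine Nat.mod_eq_of_lt (Nat.div_lt_of_lt_mul ?_)
    rw [← pow_succ]; exact x.2
  have hf : ∀ i : Fin d, ∀ y, ‖halfRangeFactor d i.castSucc y‖ ^ 2 = 1 / 2 := by
    intro i y
    rw [halfRangeFactor, if_neg (Fin.castSucc_lt_last i).ne]
    exact norm_inv_sqrt_two_sq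
  have hl : ∀ y : Fin 2, ‖halfRangeFactor d (Fin.last d) y‖ ^ 2 = if (y : ℕ) = 0 then 1 else 0 := by
    intro y
    rw [halfRangeFactor, if_pos rfl]
    fin_cases y <;> simp
  rw [Fin.prod_univ_castSucc]
  simp only [hf, hl, hlast, Nat.div_eq_zero_iff]
  simp

lemma sum_range_ite_add_lt (N i : ℕ) (hi : i ≤ N) :
    ∑ j ∈ Finset.range N, (if i + j < N then (1 : ℝ) else -1) = N - 2 * i := by
  -- With `N = c + i`, the first `c` values of `j` produce no carry and the last `i` do.
  obtain ⟨c, rfl⟩ := Nat.exists_eq_add_of_le' hi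
  rw [Finset.sum_range_add, Finset.sum_congr rfl fun j hj => if_pos (by simp at hj; omega),
    Finset.sum_congr (s₁ := Finset.range i) rfl fun j _ => if_neg (by omega)]
  simp
  ring

lemma sum_range_sum_range_ite_add_lt (N : ℕ) :
    ∑ i ∈ Finset.range N, ∑ j ∈ Finset.range N, (if i + j < N then (1 : ℝ) else -1) = N := by
  have h : ∀ K : ℕ, ∑ i ∈ Finset.range K, ((N : ℝ) - 2 * i) = K * N - K * (K - 1) := by
    intro K
    induction K with
    | zero => simp
    | succ K ih => rw [Finset.sum_range_succ, ih]; push_cast; ring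
  rw [Finset.sum_congr rfl fun i hi => sum_range_ite_add_lt N i (Finset.mem_range.mp hi).le, h]
  ring

lemma sum_fin_ite_lt (d : ℕ) (f : ℕ → ℝ) :
    ∑ x : Fin (2 ^ (d + 1)), (if (x : ℕ) < 2 ^ d then f x else 0) =
      ∑ x ∈ Finset.range (2 ^ d), f x := by
  rw [Fin.sum_univ_eq_sum_range (fun x => if x < 2 ^ d then f x else 0), pow_succ, mul_two,
    Finset.sum_range_add, Finset.sum_congr rfl fun j hj => if_pos (Finset.mem_range.mp hj)]
  simp

/-- Both summands are below `2 ^ d`, so the sum does not wrap modulo `2 ^ (d + 1)` and its top bit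
is exactly the carry. -/
lemma addBits_last (d : ℕ) (x y : Fin (2 ^ (d + 1))) (hx : (x : ℕ) < 2 ^ d)
    (hy : (y : ℕ) < 2 ^ d) :
    (-1 : ℝ) ^ (addBits (d + 1) (Sum.elim (finFunctionFinEquiv.symm x) (finFunctionFinEquiv.symm y))
      (Sum.inr (Fin.last d)) : ℕ) = if (x : ℕ) + y < 2 ^ d then 1 else -1 := by
  have hp : 2 ^ (d + 1) = 2 ^ d * 2 := pow_succ 2 d
  have h : (addBits (d + 1) (Sum.elim (finFunctionFinEquiv.symm x) (finFunctionFinEquiv.symm y))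
      (Sum.inr (Fin.last d)) : ℕ) = ((x : ℕ) + y) / 2 ^ d := by
    simp only [addBits, Sum.elim_inl, Sum.elim_inr, Equiv.apply_symm_apply,
      finFunctionFinEquiv_symm_apply_val, Fin.val_last, Fin.val_add]
    rw [Nat.mod_eq_of_lt (a := (x : ℕ) + y) (by omega),
      Nat.mod_eq_of_lt (Nat.div_lt_of_lt_mul (by omega))]
  rw [h]
  split_ifs with hlt
  · rw [Nat.div_eq_of_lt hlt, pow_zero]
  · rw [Nat.div_eq_of_lt_le (k := 1) (by omega) (by omega), pow_one]

lemma expVal_adder_halfRangeState (d : ℕ) :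
    expVal (pauliOp (pauliZ (Sum.inr (Fin.last d)))) (adder (d + 1) *ᵥ halfRangeState d) =
      1 / 2 ^ d := by
  have hterm : ∀ x y : Fin (2 ^ (d + 1)),
      (-1 : ℝ) ^ (addBits (d + 1) (Sum.elim (finFunctionFinEquiv.symm x)
        (finFunctionFinEquiv.symm y)) (Sum.inr (Fin.last d)) : ℕ) *
      ‖halfRangeState d (Sum.elim (finFunctionFinEquiv.symm x) (finFunctionFinEquiv.symm y))‖ ^ 2 =
      (1 / 2) ^ d * (1 / 2) ^ d * if (x : ℕ) < 2 ^ d then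
        (if (y : ℕ) < 2 ^ d then (if (x : ℕ) + y < 2 ^ d then 1 else -1) else 0) else 0 := by
    intro x y
    simp only [halfRangeState, productState, Fintype.prod_sum_type, Sum.elim_inl, Sum.elim_inr,
      norm_mul, mul_pow]
    simp only [norm_prod, ← Finset.prod_pow, prod_norm_halfRangeFactor_sq]
    by_cases hx : (x : ℕ) < 2 ^ d
    · by_cases hy : (y : ℕ) < 2 ^ d
      · rw [addBits_last d x y hx hy]
        simp only [hx, hy, if_true]
        ring
      · simp [hy]
    · simp [hx]
  have hsum : ∀ x : Fin (2 ^ (d + 1)), ∑ y : Fin (2 ^ (d + 1)), (if (x : ℕ) < 2 ^ d then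
        (if (y : ℕ) < 2 ^ d then (if (x : ℕ) + y < 2 ^ d then (1 : ℝ) else -1) else 0) else 0) =
      if (x : ℕ) < 2 ^ d then
        ∑ y ∈ Finset.range (2 ^ d), (if (x : ℕ) + y < 2 ^ d then (1 : ℝ) else -1) else 0 := by
    intro x
    split_ifs
    · exact sum_fin_ite_lt d fun y => if (x : ℕ) + y < 2 ^ d then (1 : ℝ) else -1
    · simp
  -- Reindexing by the adder's permutation puts the input amplitudes against the sign of the
  -- output's top bit.
  rw [expVal_pauliZ, ← sum_addBits]
  simp only [adder_mulVec_addBits]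
  rw [sum_sum_type_arrow, ← Equiv.sum_comp finFunctionFinEquiv.symm]
  simp only [← Equiv.sum_comp (finFunctionFinEquiv (m := 2) (n := d + 1)).symm (fun y => _ * _),
    hterm, ← Finset.mul_sum, hsum]
  rw [sum_fin_ite_lt d fun x => ∑ y ∈ Finset.range (2 ^ d), if x + y < 2 ^ d then (1 : ℝ) else -1,
    sum_range_sum_range_ite_add_lt]
  push_cast
  rw [one_div_pow]
  field_simp

end Stabilizer

theorem mainTheorem9 (n : ℕ) (hn : 3 ≤ n) (k m : ℕ)
    (p : Stabilizer.Protocol (Stabilizer.Register (Fin n ⊕ Fin n) k m))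
    (hp : Stabilizer.Implements p (Stabilizer.adder n)) :
    n - 2 ≤ k := by
  -- The argument gives `d = n - 1 ≤ k`, one better than the stated bound.
  obtain ⟨d, rfl⟩ : ∃ d, n = d + 1 := ⟨n - 1, by omega⟩
  have h1 := Stabilizer.normSq_halfRangeState d
  have h := hp.le_of_expVal_eq (Stabilizer.isDyadic_halfRangeState d) h1
    ((Stabilizer.normSq_adder_mulVec _ _).trans h1) _ (Stabilizer.expVal_adder_halfRangeState d)
  omega
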